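/- Let $\mathbb F_q$ be the finite field with $q$ elements, and let $\mathscr C \le \mathbb F_q^n$ be a linear code, i.e. a linear subspace. For $x\in\mathbb F_q^n$ let $\sigma(x)=\{i : x_i\neq 0\}$ be its Hamming support and $w(x)=|\sigma(x)|$ its Hamming weight. The minimum distance of $\mathscr C$ is $d=\min\{w(x) : x\in\mathscr C\setminus\{0\}\}$, where the zero code has minimum distance $n+1$. For an integer $t\ge 0$, the code $\mathscr C$ is called $t$-intersecting if $|\sigma(v)\cap\sigma(w)|\ge t$ for all $v,w\in\mathscr C\setminus\{0\}$ (including $v=w$). Let $W_d(\mathscr C)=|\{x\in\mathscr C : w(x)=d\}|$. If $\mathscr C$ is $t$-intersecting with minimum distance $d$ and $n\ge (t+1)(d-t+1)$, then $$W_d(\mathscr C)\le (q-1)\binom{n-t}{d-t}.$$ (If $\mathscr C\neq\{0\}$, then $t\le d\le n$ automatically. If $\mathscr C=\{0\}$, then $W_d(\mathscr C)=0$, and a negative entry of the binomial coefficient is read as $0$.) -/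

import Mathlib

namespace IntersectingCode

/-- The Hamming support of a vector: the set of coordinates where it is non-zero.
Its cardinality is the Hamming weight `hammingNorm x`. -/
def hammingSupport {F : Type*} [Field F] [DecidableEq F] {n : ℕ} (x : Fin n → F) :
    Finset (Fin n) :=
  Finset.univ.filter (fun i => x i ≠ 0)

/-- A linear code is `t`-intersecting if the supports of any two non-zero codewords (possibly
equal) have at least `t` coordinates in common. -/
def IsIntersecting {F : Type*} [Field F] [DecidableEq F] {n : ℕ} (t : ℕ)
    (C : Submodule F (Fin n → F)) : Prop :=
  ∀ v ∈ C, ∀ w ∈ C, v ≠ 0 → w ≠ 0 → t ≤ (hammingSupport v ∩ hammingSupport w).card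

open Classical in
/-- The minimum distance of a linear code: the least Hamming weight of a non-zero codeword,
where the zero code of length `n` has minimum distance `n + 1`. -/
noncomputable def minDistance {F : Type*} [Field F] [DecidableEq F] {n : ℕ}
    (C : Submodule F (Fin n → F)) : ℕ :=
  if C = ⊥ then n + 1 else sInf {w : ℕ | ∃ x ∈ C, x ≠ 0 ∧ hammingNorm x = w}

/-- The number `W_i(C)` of codewords of Hamming weight `i`. -/
noncomputable def weightCount {F : Type*} [Field F] [DecidableEq F] {n : ℕ}
    (C : Submodule F (Fin n → F)) (i : ℕ) : ℕ :=
  Set.ncard {x : Fin n → F | x ∈ C ∧ hammingNorm x = i}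

end IntersectingCode

/-! Minimum-weight codewords with equal support are proportional, so it suffices to bound the family
`P` of their supports, which are sets of size `d = t + r`. The intersection property forces
dimension at most `r + 1`, hence each `X ∈ P` is determined by some `r`-set disjoint from `X`.
Different `X` never share such a set, so `P.card * b ≤ U.card.choose r` if each `X` has `b` of them
inside `U` (`card_mul_le_choose`). Let `U` be the set of coordinates used by the code. If `U.card ≤
n - t`, then `b = 1` suffices. Otherwise exchange gives `b = (t - 1) * (r - 1) + 2`
(`Determines.card_filter_ge`), which outweighs the ratio of `n.choose r` to `(n - t).choose r`
(`choose_le_mul_choose`). -/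

namespace IntersectingCode

/-! ### Determining sets: deletion and exchange -/

/-- If a non-zero codeword vanishes on `G` and the code has dimension at most `#G`, then the
restriction of the code to `G` is not surjective. -/
lemma restrict_not_surjective {F : Type*} [Field F] {n : ℕ}
    (C : Submodule F (Fin n → F)) (G : Finset (Fin n))
    {x : Fin n → F} (hx : x ∈ C) (hx0 : x ≠ 0) (hxG : ∀ i ∈ G, x i = 0)
    (hdim : Module.finrank F C ≤ G.card) :
    ¬ Function.Surjective ((LinearMap.funLeft F F (Subtype.val : G → Fin n)) ∘ₗ C.subtype) := by
  intro hs
  set f := (LinearMap.funLeft F F (Subtype.val : G → Fin n)) ∘ₗ C.subtype with hf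
  have h1 := LinearMap.finrank_range_add_finrank_ker f
  rw [LinearMap.range_eq_top.2 hs, finrank_top, Module.finrank_fintype_fun_eq_card,
    Fintype.card_coe] at h1
  have h2 : Module.finrank F (LinearMap.ker f) = 0 := by omega
  rw [Submodule.finrank_eq_zero] at h2
  have h3 : (⟨x, hx⟩ : C) ∈ LinearMap.ker f := by
    rw [LinearMap.mem_ker]
    ext i
    simpa [hf, LinearMap.funLeft_apply] using hxG i i.2
  rw [h2, Submodule.mem_bot] at h3
  exact hx0 (congrArg Subtype.val h3)

variable {F : Type*} [Field F] [DecidableEq F] {n : ℕ}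

lemma mem_hammingSupport {x : Fin n → F} {i : Fin n} : i ∈ hammingSupport x ↔ x i ≠ 0 := by
  simp [hammingSupport]

lemma card_hammingSupport (x : Fin n → F) : (hammingSupport x).card = hammingNorm x := by
  simp [hammingSupport, hammingNorm]

/-- A set `G` of coordinates determines `X` in the code `C` if every codeword vanishing on `G`
is supported in `X`. -/
def Determines (C : Submodule F (Fin n → F)) (X G : Finset (Fin n)) : Prop :=
  ∀ y ∈ C, (∀ i ∈ G, y i = 0) → hammingSupport y ⊆ X

/-- If no `i ≠ e` could be deleted, the restriction of `C` to `G` would contain every unit vector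
except perhaps the one at `e`, and `w` would supply that one, contradicting non-surjectivity. -/
lemma Determines.exists_erase {C : Submodule F (Fin n → F)} {G X : Finset (Fin n)}
    {x : Fin n → F} (hx : x ∈ C) (hx0 : x ≠ 0) (hxG : ∀ i ∈ G, x i = 0)
    (hdim : Module.finrank F C ≤ G.card) (hG : Determines C X G)
    {w : Fin n → F} (hw : w ∈ C) {e : Fin n} (hwe : w e ≠ 0) :
    ∃ i ∈ G, i ≠ e ∧ Determines C X (G.erase i) := by
  by_contra! hcon
  refine restrict_not_surjective C G hx hx0 hxG hdim ?_
  set f := (LinearMap.funLeft F F (Subtype.val : G → Fin n)) ∘ₗ C.subtype with hf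
  have happ : ∀ (y : Fin n → F) (hy : y ∈ C) (j : G), f ⟨y, hy⟩ j = y j := fun y hy j => rfl
  have hsingle : ∀ i : G, (i : Fin n) ≠ e → Pi.single i (1 : F) ∈ LinearMap.range f := by
    intro i hie
    have h1 := hcon i i.2 hie
    simp only [Determines] at h1
    push Not at h1
    obtain ⟨y, hy, hyG, hyX⟩ := h1
    have hyi : y i ≠ 0 := by
      intro h0
      refine hyX (hG y hy fun j hj => ?_)
      by_cases hji : j = i
      · rw [hji, h0]
      · exact hyG j (Finset.mem_erase.2 ⟨hji, hj⟩)
    refine ⟨(y i)⁻¹ • ⟨y, hy⟩, ?_⟩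
    ext j
    rw [map_smul, Pi.smul_apply, happ, smul_eq_mul]
    by_cases hji : j = i
    · subst hji
      rw [Pi.single_eq_same, inv_mul_cancel₀ hyi]
    · rw [Pi.single_eq_of_ne hji,
        hyG j (Finset.mem_erase.2 ⟨fun h => hji (Subtype.ext h), j.2⟩), mul_zero]
  have hall : ∀ i : G, Pi.single i (1 : F) ∈ LinearMap.range f := by
    intro i
    by_cases hie : (i : Fin n) = e
    · have hwi : w i ≠ 0 := by rwa [hie]
      have hsum : ∑ j : G, w j • Pi.single j (1 : F) = f ⟨w, hw⟩ := by
        ext k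
        simp [happ, Finset.sum_apply, Pi.single_apply]
      rw [← Finset.add_sum_erase _ _ (Finset.mem_univ i)] at hsum
      have h2 : ∑ j ∈ Finset.univ.erase i, w j • Pi.single j (1 : F) ∈ LinearMap.range f := by
        refine Submodule.sum_mem _ fun j hj => Submodule.smul_mem _ _ (hsingle j ?_)
        intro hje
        exact (Finset.mem_erase.1 hj).1 (Subtype.ext (hje.trans hie.symm))
      have h3 : w i • Pi.single i (1 : F) ∈ LinearMap.range f := by
        rw [eq_sub_of_add_eq hsum]
        exact Submodule.sub_mem _ ⟨_, rfl⟩ h2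
      have h4 := Submodule.smul_mem _ (w i)⁻¹ h3
      rwa [smul_smul, inv_mul_cancel₀ hwi, one_smul] at h4
    · exact hsingle i hie
  rw [← LinearMap.range_eq_top, eq_top_iff]
  intro v _
  have hv : v = ∑ j : G, v j • Pi.single j (1 : F) := by
    ext k
    simp [Finset.sum_apply, Pi.single_apply]
  rw [hv]
  exact Submodule.sum_mem _ fun j _ => Submodule.smul_mem _ _ (hall j)

lemma Determines.exists_subset_card_eq {C : Submodule F (Fin n → F)} {X : Finset (Fin n)}
    {x : Fin n → F} (hx : x ∈ C) (hx0 : x ≠ 0) {r : ℕ} (hdim : Module.finrank F C ≤ r + 1)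
    {G : Finset (Fin n)} (hxG : ∀ i ∈ G, x i = 0) (hG : Determines C X G) (hr : r ≤ G.card) :
    ∃ H ⊆ G, H.card = r ∧ Determines C X H := by
  -- Since `x` vanishes on `G`, this `e` lies outside `G`, so protecting it costs nothing.
  obtain ⟨e, he⟩ := Function.ne_iff.1 hx0
  obtain ⟨m, hm⟩ := Nat.exists_eq_add_of_le hr
  induction m generalizing G with
  | zero => exact ⟨G, subset_rfl, hm, hG⟩
  | succ m ih =>
    obtain ⟨i, hi, -, hdet⟩ := hG.exists_erase hx hx0 hxG (by omega) hx he
    have hc := Finset.card_erase_of_mem hi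
    obtain ⟨H, hH, hHc, hHd⟩ := ih (fun j hj => hxG j (Finset.mem_of_mem_erase hj)) hdet
      (by omega) (by omega)
    exact ⟨H, hH.trans (Finset.erase_subset _ _), hHc, hHd⟩

open Classical in
/-- By exchange, a determining set all of whose coordinates are used by the code contains many
determining subsets of size `r`. -/
lemma Determines.card_filter_ge {C : Submodule F (Fin n → F)} {X : Finset (Fin n)}
    {x : Fin n → F} (hx : x ∈ C) (hx0 : x ≠ 0) {r : ℕ} (hdim : Module.finrank F C ≤ r + 1)
    {G : Finset (Fin n)} (hxG : ∀ i ∈ G, x i = 0) (hG : Determines C X G) (hr : r ≤ G.card)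
    (huse : ∀ e ∈ G, ∃ w ∈ C, w e ≠ 0) :
    G.card - r + 1 ≤ ((G.powersetCard r).filter (Determines C X)).card := by
  obtain ⟨H, hHG, hHc, hHd⟩ := hG.exists_subset_card_eq hx hx0 hdim hxG hr
  have hex : ∀ e ∈ G \ H, ∃ i ∈ insert e H, i ≠ e ∧ Determines C X ((insert e H).erase i) := by
    intro e he
    rw [Finset.mem_sdiff] at he
    obtain ⟨w, hw, hwe⟩ := huse e he.1
    refine Determines.exists_erase hx hx0 ?_ ?_ ?_ hw hwe
    · intro i hi
      rcases Finset.mem_insert.1 hi with rfl | hi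
      · exact hxG _ he.1
      · exact hxG _ (hHG hi)
    · rw [Finset.card_insert_of_notMem he.2]
      omega
    · exact fun y hy h => hHd y hy fun i hi => h i (Finset.mem_insert_of_mem hi)
  choose! φ hφ using hex
  -- The exchanged set keeps `e`, its only element outside `H`; hence these sets are distinct and
  -- differ from `H`.
  have hmem : ∀ e ∈ G \ H, e ∈ (insert e H).erase (φ e) := fun e he =>
    Finset.mem_erase.2 ⟨(hφ e he).2.1.symm, Finset.mem_insert_self _ _⟩
  have hinj : Set.InjOn (fun e => (insert e H).erase (φ e)) (G \ H : Finset (Fin n)) := by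
    intro e he e' he' h
    have h1 := hmem e he
    change (insert e H).erase (φ e) = (insert e' H).erase (φ e') at h
    rw [h] at h1
    rcases Finset.mem_insert.1 (Finset.mem_of_mem_erase h1) with h2 | h2
    · exact h2
    · exact absurd h2 (Finset.mem_sdiff.1 he).2
  have hH : H ∉ (G \ H).image (fun e => (insert e H).erase (φ e)) := by
    intro h
    obtain ⟨e, he, heq⟩ := Finset.mem_image.1 h
    have h1 := hmem e he
    rw [heq] at h1
    exact (Finset.mem_sdiff.1 he).2 h1
  have hcard : (insert H ((G \ H).image fun e => (insert e H).erase (φ e))).card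
      = G.card - r + 1 := by
    rw [Finset.card_insert_of_notMem hH, Finset.card_image_of_injOn hinj,
      Finset.card_sdiff_of_subset hHG, hHc]
  rw [← hcard]
  refine Finset.card_le_card fun K hK => ?_
  rw [Finset.mem_filter, Finset.mem_powersetCard]
  rcases Finset.mem_insert.1 hK with rfl | hK
  · exact ⟨⟨hHG, hHc⟩, hHd⟩
  · obtain ⟨e, he, rfl⟩ := Finset.mem_image.1 hK
    have he' := Finset.mem_sdiff.1 he
    refine ⟨⟨(Finset.erase_subset _ _).trans (Finset.insert_subset he'.1 hHG), ?_⟩, (hφ e he).2.2⟩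
    rw [Finset.card_erase_of_mem (hφ e he).1, Finset.card_insert_of_notMem he'.2, hHc]
    rfl

/-! ### Counting supports through determining sets -/

-- If `G` determines `X` and avoids `X'`, the codeword with support `X'` vanishes on `G`, so `X' ⊆
-- X`. By symmetry the families attached to distinct supports are disjoint.
open Classical in
lemma card_mul_le_choose {C : Submodule F (Fin n → F)} {P : Finset (Finset (Fin n))}
    (hP : ∀ X ∈ P, ∃ x ∈ C, hammingSupport x = X) {U : Finset (Fin n)} {r b : ℕ}
    (hb : ∀ X ∈ P, b ≤ (((U \ X).powersetCard r).filter (Determines C X)).card) :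
    P.card * b ≤ U.card.choose r := by
  have hsub : ∀ X ∈ P, ∀ X' ∈ P, ∀ G ∈ ((U \ X).powersetCard r).filter (Determines C X),
      G ∈ ((U \ X').powersetCard r).filter (Determines C X') → X' ⊆ X := by
    intro X _ X' hX' G hG hG'
    obtain ⟨y, hy, rfl⟩ := hP X' hX'
    refine (Finset.mem_filter.1 hG).2 y hy fun i hi => ?_
    have h1 := (Finset.mem_powersetCard.1 (Finset.mem_filter.1 hG').1).1 hi
    by_contra h0
    exact (Finset.mem_sdiff.1 h1).2 (mem_hammingSupport.2 h0)
  rw [← Finset.card_powersetCard, ← smul_eq_mul]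
  refine (Finset.card_nsmul_le_sum P _ b hb).trans ?_
  rw [← Finset.card_biUnion]
  · refine Finset.card_le_card (Finset.biUnion_subset.2 fun X _ => ?_)
    exact (Finset.filter_subset _ _).trans (Finset.powersetCard_mono Finset.sdiff_subset)
  · intro X hX X' hX' hne
    refine Finset.disjoint_left.2 fun G hG hG' => hne ?_
    exact (hsub X' hX' X hX G hG' hG).antisymm (hsub X hX X' hX' G hG hG')

/-- The Singleton bound on the support of a codeword of an intersecting code. -/
lemma IsIntersecting.finrank_le {C : Submodule F (Fin n → F)} {t : ℕ} (hC : IsIntersecting t C)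
    (ht : 1 ≤ t) {x : Fin n → F} (hx : x ∈ C) (hx0 : x ≠ 0) :
    Module.finrank F C ≤ (hammingSupport x).card - t + 1 := by
  have hxt : t ≤ (hammingSupport x).card := by simpa using hC x hx x hx hx0 hx0
  -- A non-zero codeword vanishing on `J` would meet the support of `x` in at most `t - 1`
  -- coordinates.
  obtain ⟨J, hJX, hJ⟩ := Finset.exists_subset_card_eq
    (show (hammingSupport x).card - t + 1 ≤ (hammingSupport x).card by omega)
  have hinj : Function.Injective
      ((LinearMap.funLeft F F (Subtype.val : J → Fin n)) ∘ₗ C.subtype) := by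
    rw [← LinearMap.ker_eq_bot, LinearMap.ker_eq_bot']
    rintro ⟨y, hy⟩ h
    by_contra hy0
    have hy0' : y ≠ 0 := fun h0 => hy0 (Subtype.ext h0)
    have h1 := hC x hx y hy hx0 hy0'
    have h2 : hammingSupport x ∩ hammingSupport y ⊆ hammingSupport x \ J := by
      intro i hi
      rw [Finset.mem_inter] at hi
      refine Finset.mem_sdiff.2 ⟨hi.1, fun hiJ => mem_hammingSupport.1 hi.2 ?_⟩
      exact congrFun h ⟨i, hiJ⟩
    have h3 := Finset.card_le_card h2
    rw [Finset.card_sdiff_of_subset hJX] at h3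
    omega
  have h := LinearMap.finrank_le_finrank_of_injective hinj
  rwa [Module.finrank_fintype_fun_eq_card, Fintype.card_coe, hJ] at h

/-! ### Binomial estimates -/

lemma succ_pow_le_three_mul_pow (r : ℕ) : (r + 1) ^ r ≤ 3 * r ^ r := by
  rcases Nat.eq_zero_or_pos r with rfl | hr
  · norm_num
  have hr' : (0 : ℝ) < r := by exact_mod_cast hr
  have h1 : (1 + 1 / (r : ℝ)) ^ r ≤ 3 := by
    have h2 : 1 + 1 / (r : ℝ) ≤ Real.exp (1 / r) := by
      linarith [Real.add_one_le_exp (1 / (r : ℝ))]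
    calc (1 + 1 / (r : ℝ)) ^ r ≤ Real.exp (1 / r) ^ r := by gcongr
      _ = Real.exp 1 := by
        rw [← Real.exp_nat_mul]
        congr 1
        field_simp
      _ ≤ 3 := by linarith [Real.exp_one_lt_d9]
  have h3 : ((r : ℝ) + 1) ^ r = (1 + 1 / (r : ℝ)) ^ r * (r : ℝ) ^ r := by
    rw [← mul_pow]
    congr 1
    field_simp
  have h4 : ((r : ℝ) + 1) ^ r ≤ 3 * (r : ℝ) ^ r := by
    rw [h3]
    gcongr
  exact_mod_cast h4

lemma descFactorial_mul_pow_le {n t r : ℕ} (hn : (t + 1) * (r + 1) ≤ n) {j : ℕ} (hj : j ≤ r) :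
    n.descFactorial j * r ^ j ≤ (n - t).descFactorial j * (r + 1) ^ j := by
  induction j with
  | zero => simp
  | succ j ih =>
    -- This amounts to `t * r ≤ n - t - j`.
    have h1 : (n - j) * r ≤ (n - t - j) * (r + 1) := by
      have h2 : t + j ≤ n := by nlinarith
      obtain ⟨m, rfl⟩ := Nat.exists_eq_add_of_le h2
      have e1 : t + j + m - j = t + m := by omega
      have e2 : t + j + m - t - j = m := by omega
      rw [e1, e2]
      nlinarith
    rw [Nat.descFactorial_succ, Nat.descFactorial_succ, pow_succ, pow_succ]
    calc (n - j) * n.descFactorial j * (r ^ j * r)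
        = ((n - j) * r) * (n.descFactorial j * r ^ j) := by ring
      _ ≤ ((n - t - j) * (r + 1)) * ((n - t).descFactorial j * (r + 1) ^ j) :=
        Nat.mul_le_mul h1 (ih (by omega))
      _ = _ := by ring

lemma choose_le_three_mul_choose {n t r : ℕ} (hr : 1 ≤ r) (hn : (t + 1) * (r + 1) ≤ n) :
    n.choose r ≤ 3 * (n - t).choose r := by
  have h1 := descFactorial_mul_pow_le hn le_rfl
  have h2 : n.descFactorial r ≤ 3 * (n - t).descFactorial r := by
    refine Nat.le_of_mul_le_mul_right ?_ (pow_pos hr r)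
    calc n.descFactorial r * r ^ r ≤ (n - t).descFactorial r * (r + 1) ^ r := h1
      _ ≤ (n - t).descFactorial r * (3 * r ^ r) :=
        Nat.mul_le_mul le_rfl (succ_pow_le_three_mul_pow r)
      _ = _ := by ring
  rw [Nat.descFactorial_eq_factorial_mul_choose, Nat.descFactorial_eq_factorial_mul_choose] at h2
  refine Nat.le_of_mul_le_mul_left ?_ (Nat.factorial_pos r)
  linarith

lemma choose_le_two_mul_choose_sub_one {n r : ℕ} (hn : 2 * (r + 1) ≤ n) :
    n.choose r ≤ 2 * (n - 1).choose r := by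
  obtain ⟨m, rfl⟩ : ∃ m, n = m + 1 := ⟨n - 1, by omega⟩
  have h2 := Nat.choose_mul_succ_eq m r
  have h3 : m + 1 ≤ 2 * (m + 1 - r) := by omega
  rw [Nat.add_sub_cancel]
  refine Nat.le_of_mul_le_mul_right (c := m + 1 - r) ?_ (by omega)
  calc (m + 1).choose r * (m + 1 - r) = m.choose r * (m + 1) := h2.symm
    _ ≤ m.choose r * (2 * (m + 1 - r)) := Nat.mul_le_mul le_rfl h3
    _ = _ := by ring

/-- The ratio of the binomials is at most 2 if `r = 1` or `t = 1`, and at most `(1 + 1 / r) ^ r ≤ 3`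
in general; `b` is at least 3 once both exceed 1. -/
lemma choose_le_mul_choose {n t r b : ℕ} (ht : 1 ≤ t) (hr : 1 ≤ r)
    (hn : (t + 1) * (r + 1) ≤ n) (hb : (t - 1) * (r - 1) + 2 ≤ b) :
    n.choose r ≤ (n - t).choose r * b := by
  by_cases hr1 : r = 1
  · subst hr1
    rw [Nat.choose_one_right, Nat.choose_one_right]
    calc n ≤ (n - t) * 2 := by omega
      _ ≤ _ := Nat.mul_le_mul le_rfl (by omega)
  by_cases ht1 : t = 1
  · subst ht1
    calc n.choose r ≤ 2 * (n - 1).choose r := choose_le_two_mul_choose_sub_one hn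
      _ = (n - 1).choose r * 2 := mul_comm _ _
      _ ≤ _ := Nat.mul_le_mul le_rfl (by omega)
  · have h1 : 1 ≤ (t - 1) * (r - 1) := Nat.mul_pos (by omega) (by omega)
    calc n.choose r ≤ 3 * (n - t).choose r := choose_le_three_mul_choose hr hn
      _ = (n - t).choose r * 3 := mul_comm _ _
      _ ≤ _ := Nat.mul_le_mul le_rfl (by omega)

/-! ### Bounding the number of supports -/

lemma determines_sdiff {C : Submodule F (Fin n → F)} {U : Finset (Fin n)}
    (hU : ∀ y ∈ C, hammingSupport y ⊆ U) (X : Finset (Fin n)) : Determines C X (U \ X) := by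
  intro y hy h i hi
  by_contra hiX
  exact mem_hammingSupport.1 hi (h i (Finset.mem_sdiff.2 ⟨hU y hy hi, hiX⟩))

/-- In a `t`-intersecting code, a family of supports of size `t + r` of non-zero codewords has at
most `(n - t).choose r` members, provided that `(t + 1) * (r + 1) ≤ n`. -/
lemma IsIntersecting.card_supports_le {C : Submodule F (Fin n → F)} {t r : ℕ}
    (hC : IsIntersecting t C) (hn : (t + 1) * (r + 1) ≤ n) {P : Finset (Finset (Fin n))}
    (hP : ∀ X ∈ P, ∃ x ∈ C, x ≠ 0 ∧ hammingSupport x = X) (hPc : ∀ X ∈ P, X.card = t + r) :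
    P.card ≤ (n - t).choose r := by
  classical
  rcases Nat.eq_zero_or_pos t with rfl | ht
  · have h : P ⊆ (Finset.univ : Finset (Fin n)).powersetCard r := fun X hX =>
      Finset.mem_powersetCard.2 ⟨Finset.subset_univ _, by simpa using hPc X hX⟩
    simpa using Finset.card_le_card h
  have hP' : ∀ X ∈ P, ∃ x ∈ C, hammingSupport x = X := fun X hX => by
    obtain ⟨x, hx, -, h⟩ := hP X hX
    exact ⟨x, hx, h⟩
  have hdim : ∀ X ∈ P, Module.finrank F C ≤ r + 1 := by
    intro X hX
    obtain ⟨x, hx, hx0, rfl⟩ := hP X hX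
    have h := hC.finrank_le ht hx hx0
    rwa [hPc _ hX, Nat.add_sub_cancel_left] at h
  have hvanish : ∀ (x : Fin n → F) (U : Finset (Fin n)), ∀ i ∈ U \ hammingSupport x, x i = 0 := by
    intro x U i hi
    by_contra h0
    exact (Finset.mem_sdiff.1 hi).2 (mem_hammingSupport.2 h0)
  have hone : ∀ U : Finset (Fin n), (∀ y ∈ C, hammingSupport y ⊆ U) → t + 2 * r ≤ U.card →
      P.card ≤ U.card.choose r := by
    intro U hU hUc
    rw [← mul_one P.card]
    refine card_mul_le_choose hP' fun X hX => ?_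
    obtain ⟨x, hx, hx0, rfl⟩ := hP X hX
    have h1 := Finset.le_card_sdiff (hammingSupport x) U
    rw [hPc _ hX] at h1
    obtain ⟨H, hHs, hHc, hHd⟩ := (determines_sdiff hU (hammingSupport x)).exists_subset_card_eq
      hx hx0 (hdim _ hX) (hvanish x U) (by omega)
    exact Finset.card_pos.2 ⟨H, Finset.mem_filter.2 ⟨Finset.mem_powersetCard.2 ⟨hHs, hHc⟩, hHd⟩⟩
  rcases Nat.eq_zero_or_pos r with rfl | hr
  · have h := hone Finset.univ (fun _ _ => Finset.subset_univ _) (by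
      rw [Finset.card_univ, Fintype.card_fin]
      omega)
    simpa using h
  obtain ⟨s, rfl⟩ : ∃ s, t = s + 1 := ⟨t - 1, by omega⟩
  obtain ⟨p, rfl⟩ : ∃ p, r = p + 1 := ⟨r - 1, by omega⟩
  set U : Finset (Fin n) := Finset.univ.filter fun i => ∃ w ∈ C, w i ≠ 0 with hUdef
  have hU : ∀ y ∈ C, hammingSupport y ⊆ U := fun y hy i hi =>
    Finset.mem_filter.2 ⟨Finset.mem_univ i, y, hy, mem_hammingSupport.1 hi⟩
  have hUn : U.card ≤ n := by simpa using Finset.card_le_univ U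
  have hn' : s * p + 2 * s + 2 * p + 4 ≤ n := by nlinarith
  by_cases hcase : U.card ≤ n - (s + 1)
  · obtain ⟨V, hUV, -, hV⟩ := Finset.exists_subsuperset_card_eq (Finset.subset_univ U) hcase
      (by simp)
    have h := hone V (fun y hy => (hU y hy).trans hUV) (by
      rw [hV]
      generalize s * p = m at hn'
      omega)
    rwa [hV] at h
  -- Here `U.card ≥ n - s`, so exchange gives at least `n - 2 * s - 2 * p - 2 ≥ s * p + 2`
  -- determining sets.
  · have hb : P.card * (s * p + 2) ≤ U.card.choose (p + 1) := by
      refine card_mul_le_choose hP' fun X hX => ?_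
      obtain ⟨x, hx, hx0, rfl⟩ := hP X hX
      have hc := Finset.card_sdiff_of_subset (hU x hx)
      rw [hPc _ hX] at hc
      refine le_trans ?_ ((determines_sdiff hU (hammingSupport x)).card_filter_ge
        hx hx0 (hdim _ hX) (hvanish x U) ?_ ?_)
      · generalize s * p = m at hn' ⊢
        omega
      · generalize s * p = m at hn' ⊢
        omega
      · exact fun e he => (Finset.mem_filter.1 (Finset.mem_sdiff.1 he).1).2
    have h1 : n.choose (p + 1) ≤ (n - (s + 1)).choose (p + 1) * (s * p + 2) :=
      choose_le_mul_choose ht hr hn le_rfl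
    refine Nat.le_of_mul_le_mul_right (c := s * p + 2) ?_ (by omega)
    exact hb.trans ((Nat.choose_le_choose _ hUn).trans h1)

/-! ### From supports to codewords -/

lemma minDistance_le {C : Submodule F (Fin n → F)} {x : Fin n → F} (hx : x ∈ C) (hx0 : x ≠ 0) :
    minDistance C ≤ (hammingSupport x).card := by
  have hC : C ≠ ⊥ := fun h => hx0 (by rwa [h, Submodule.mem_bot] at hx)
  rw [minDistance, if_neg hC]
  exact Nat.sInf_le ⟨x, hx, hx0, (card_hammingSupport x).symm⟩

lemma eq_of_hammingSupport_eq {C : Submodule F (Fin n → F)} {x y : Fin n → F} (hx : x ∈ C)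
    (hy : y ∈ C) (hxd : (hammingSupport x).card = minDistance C)
    (hxy : hammingSupport x = hammingSupport y) {i : Fin n} (hi : i ∈ hammingSupport x)
    (h : x i = y i) : x = y := by
  by_contra hne
  -- The difference loses coordinate `i`, so it would be lighter than the minimum distance.
  have h1 := minDistance_le (C.sub_mem hx hy) (sub_ne_zero.2 hne)
  have h2 : hammingSupport (x - y) ⊆ (hammingSupport x).erase i := by
    intro j hj
    rw [mem_hammingSupport, Pi.sub_apply] at hj
    refine Finset.mem_erase.2 ⟨?_, ?_⟩
    · rintro rfl
      exact hj (sub_eq_zero.2 h)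
    · by_contra hjx
      have hjy := hxy ▸ hjx
      rw [mem_hammingSupport, not_not] at hjx hjy
      exact hj (by rw [hjx, hjy, sub_zero])
  have h3 := Finset.card_le_card h2
  have h4 := Finset.card_erase_lt_of_mem hi
  omega

open Classical in
/-- Non-zero codewords of minimum weight with the same support are proportional, so that each
support belongs to at most `q - 1` of them. -/
lemma weightCount_le [Fintype F] {C : Submodule F (Fin n → F)} (hC : C ≠ ⊥) :
    weightCount C (minDistance C) ≤ (Fintype.card F - 1) *
      ((Finset.univ.filter fun x : Fin n → F => x ∈ C ∧ x ≠ 0 ∧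
        (hammingSupport x).card = minDistance C).image hammingSupport).card := by
  have hpos : 0 < minDistance C := by
    obtain ⟨x, hx, hx0⟩ := C.exists_mem_ne_zero_of_ne_bot hC
    rw [minDistance, if_neg hC]
    obtain ⟨y, -, hy0, hy⟩ := Nat.sInf_mem
      (s := {w : ℕ | ∃ x ∈ C, x ≠ 0 ∧ hammingNorm x = w}) ⟨_, x, hx, hx0, rfl⟩
    rw [← hy]
    exact hammingNorm_pos_iff.2 hy0
  have hset : {x : Fin n → F | x ∈ C ∧ hammingNorm x = minDistance C} =
      (Finset.univ.filter fun x : Fin n → F => x ∈ C ∧ x ≠ 0 ∧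
        (hammingSupport x).card = minDistance C : Finset (Fin n → F)) := by
    ext x
    simp only [Set.mem_ofPred_eq, Finset.coe_filter, Finset.mem_univ, true_and,
      card_hammingSupport]
    refine and_congr_right fun _ => ⟨fun h => ⟨?_, h⟩, fun h => h.2⟩
    exact hammingNorm_pos_iff.1 (h ▸ hpos)
  rw [weightCount, hset, Set.ncard_coe_finset]
  refine Finset.card_le_mul_card_image _ _ fun X hX => ?_
  obtain ⟨x, hx, rfl⟩ := Finset.mem_image.1 hX
  have hxd := (Finset.mem_filter.1 hx).2.2.2
  obtain ⟨i, hi⟩ := Finset.card_pos.1 (hxd ▸ hpos)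
  have hunits : (Finset.univ.erase (0 : F)).card = Fintype.card F - 1 := by
    rw [Finset.card_erase_of_mem (Finset.mem_univ _), Finset.card_univ]
  rw [← hunits]
  refine Finset.card_le_card_of_injOn (fun y => y i) ?_ ?_
  · intro y hy
    have h := (Finset.mem_filter.1 hy).2
    rw [← h] at hi
    simpa using mem_hammingSupport.1 hi
  · intro y hy z hz h
    rw [Finset.mem_coe, Finset.mem_filter] at hy hz
    have hy' := (Finset.mem_filter.1 hy.1).2
    have hz' := (Finset.mem_filter.1 hz.1).2
    exact eq_of_hammingSupport_eq hy'.1 hz'.1 hy'.2.2 (hy.2.trans hz.2.symm) (hy.2 ▸ hi) h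

lemma weightCount_minDistance_bot : weightCount (⊥ : Submodule F (Fin n → F)) (minDistance
    (⊥ : Submodule F (Fin n → F))) = 0 := by
  have h : {x : Fin n → F | x ∈ (⊥ : Submodule F (Fin n → F)) ∧
      hammingNorm x = minDistance (⊥ : Submodule F (Fin n → F))} = ∅ := by
    refine Set.eq_empty_of_forall_notMem ?_
    rintro x ⟨hx, hxd⟩
    rw [(Submodule.mem_bot F).1 hx, hammingNorm_zero, minDistance, if_pos rfl] at hxd
    omega
  rw [weightCount, h, Set.ncard_empty]

end IntersectingCode

theorem mainTheorem7 {F : Type*} [Field F] [Fintype F] [DecidableEq F] (q n t d : ℕ)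
    (hq : Fintype.card F = q) (C : Submodule F (Fin n → F))
    (hC : IntersectingCode.IsIntersecting t C)
    (hd : IntersectingCode.minDistance C = d)
    (hn : ((t : ℤ) + 1) * ((d : ℤ) - (t : ℤ) + 1) ≤ (n : ℤ)) :
    IntersectingCode.weightCount C d ≤ (q - 1) * Nat.choose (n - t) (d - t) := by
  classical
  subst hq hd
  by_cases hbot : C = ⊥
  · subst hbot
    rw [IntersectingCode.weightCount_minDistance_bot]
    exact Nat.zero_le _
  refine (IntersectingCode.weightCount_le hbot).trans (Nat.mul_le_mul le_rfl ?_)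
  by_cases htd : t ≤ IntersectingCode.minDistance C
  · obtain ⟨r, hr⟩ := Nat.exists_eq_add_of_le htd
    rw [hr] at hn ⊢
    rw [Nat.add_sub_cancel_left]
    push_cast at hn
    rw [add_sub_cancel_left] at hn
    refine hC.card_supports_le (by exact_mod_cast hn) ?_ ?_
    · intro X hX
      obtain ⟨x, hx, rfl⟩ := Finset.mem_image.1 hX
      have h := (Finset.mem_filter.1 hx).2
      exact ⟨x, h.1, h.2.1, rfl⟩
    · intro X hX
      obtain ⟨x, hx, rfl⟩ := Finset.mem_image.1 hX
      exact (Finset.mem_filter.1 hx).2.2.2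
  -- Taking `v = w` in the intersection property gives `t` as a lower bound for every non-zero
  -- weight, so no words arise here.
  · rw [Finset.card_eq_zero.2]
    · exact Nat.zero_le _
    refine Finset.image_eq_empty.2 (Finset.filter_eq_empty_iff.2 ?_)
    rintro x - ⟨hx, hx0, hxd⟩
    have h := hC x hx x hx hx0 hx0
    rw [Finset.inter_self, hxd] at h
    exact htd h
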